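/- Call a function $f:\mathbb R\to\mathbb C$ **positive definite** if for every finite family of points $x_1,\dots,x_n\in\mathbb R$ the matrix $[f(x_i-x_j)]_{i,j}$ is (Hermitian) positive semidefinite; no continuity or measurability is assumed. Call $f$ **positive definite in the Fourier sense** if there is a finite nonnegative Borel measure $\mu$ on $\mathbb R$ with $f(x)=\int_{\mathbb R} e^{ixt}\,d\mu(t)$ for all $x\in\mathbb R$ (that is, the generalized Fourier transform of $f$ is a finite nonnegative measure). Say that $f$ is bounded away from zero if there is $c>0$ with $|f(x)|\ge c$ for all $x\in\mathbb R$. Let $\log$ denote the principal logarithm on $\mathbb C\setminus\{0\}$, with $\operatorname{Im}\log\in(-\pi,\pi]$, and let $z^\lambda=\exp(\lambda\log z)$ for $z\ne 0$ and $0^\lambda=0$, for real $\lambda>0$. **Theorem.** Let $f:\mathbb R\to\mathbb C$. 1. If $f$ is positive definite, then $x\mapsto\exp(kf(x))$ is positive definite for every real $k>0$. 2. If $x\mapsto f(x)^\lambda$ is positive definite for every real $\lambda>0$, and $f$ is bounded away from zero, then there is a constant $C\in\mathbb C$ such that $x\mapsto\log f(x)-C$ is positive definite. Both assertions also hold with "positive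 definite" replaced everywhere (in hypotheses and conclusions) by "positive definite in the Fourier sense". -/

import Mathlib

open scoped ComplexOrder

/-- A function `f : ℝ → ℂ` is positive definite if for every finite family of points `x_i` of the
real line the matrix `[f (x_i - x_j)]` is positive semidefinite. No regularity of `f` is assumed. -/
def IsPositiveDefiniteFun (f : ℝ → ℂ) : Prop :=
  ∀ (n : ℕ) (x : Fin n → ℝ),
    (Matrix.of fun i j : Fin n => f (x i - x j)).PosSemidef

/-- Positive definiteness in the Fourier sense: `f` is, at every point, the Fourier transform
`f x = ∫ t, exp (i x t) ∂μ` of a finite nonnegative Borel measure `μ` on the line, that is, the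
generalized (inverse) Fourier transform of `f` is the nonnegative finite measure `μ`. -/
def IsFourierPositive (f : ℝ → ℂ) : Prop :=
  ∃ μ : MeasureTheory.Measure ℝ, MeasureTheory.IsFiniteMeasure μ ∧
    ∀ x : ℝ, f x = ∫ t : ℝ, Complex.exp (Complex.I * (x : ℂ) * (t : ℂ)) ∂μ

/-- `|f|` is bounded below by a positive constant. -/
def IsBoundedAwayFromZero (f : ℝ → ℂ) : Prop :=
  ∃ c : ℝ, 0 < c ∧ ∀ x : ℝ, c ≤ ‖f x‖

open Filter Topology MeasureTheory

/-! Both notions give cones closed under products (Schur, resp. convolution) and pointwise limits;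
in the Fourier case Lévy's theorem needs the limit continuous at 0. The exponential series has
nonnegative coefficients, which gives the first assertion. For the second, `log f` is the limit of
`(f ^ l - 1) / l` as `l → 0⁺`, and the `-1` must be absorbed. Matrices: the `-1` vanishes on weights
summing to zero, so `log f` is conditionally positive definite, and it is bounded. Weights of total
`s` are balanced by spreading `-s` over an almost translation-invariant family; this costs at most a
constant times `‖s‖ ^ 2`, which an additive constant repays. Fourier: normalized at 0, `f ^ l` comes
from a probability measure whose mass off 0 is `O(l)`. Discarding the atom at 0 and dividing by `l`
leaves measures of bounded mass; along a subsequence their transforms converge to `log f - C`. -/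

/-! ### Almost invariant averages -/

/-- A Følner family, uniform in `g`: a sum of long arithmetic progressions, one for each step in
`S`. -/
theorem exists_almost_invariant_family (S : Finset ℝ) {ε : ℝ} (hε : 0 < ε) :
    ∃ (κ : Type) (_ : Fintype κ) (_ : Nonempty κ) (y : κ → ℝ), ∀ x ∈ S, ∀ (g : ℝ → ℂ) (B : ℝ),
      (∀ t, ‖g t‖ ≤ B) → ‖∑ k, (g (y k - x) - g (y k))‖ ≤ ε * B * Fintype.card κ := by
  induction S using Finset.induction_on with
  | empty => exact ⟨Unit, inferInstance, inferInstance, fun _ => 0, by simp⟩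
  | insert a S _ ih =>
    obtain ⟨κ, _, _, y, hy⟩ := ih
    obtain ⟨N, hN⟩ := exists_nat_gt (2 / ε)
    have hN0 : (0 : ℝ) < N := (by positivity : (0 : ℝ) < 2 / ε).trans hN
    have : NeZero N := ⟨by rintro rfl; simp at hN0⟩
    -- Shifting by `a` telescopes to two boundary terms, hence `N > 2 / ε`; the older shifts are
    -- handled on each translate of `y`.
    refine ⟨κ × Fin N, inferInstance, inferInstance, fun p => y p.1 + (p.2 : ℕ) * a, ?_⟩
    intro x hx g B hg
    have hB : 0 ≤ B := (norm_nonneg _).trans (hg 0)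
    rw [Fintype.card_prod, Fintype.card_fin]
    push_cast
    rcases Finset.mem_insert.1 hx with rfl | hx
    · rw [Fintype.sum_prod_type]
      dsimp only
      have hk : ∀ k, ‖∑ m : Fin N, (g (y k + (m : ℕ) * x - x) - g (y k + (m : ℕ) * x))‖
          ≤ 2 * B := by
        intro k
        have := Finset.sum_range_sub' (fun m : ℕ => g (y k + m * x - x)) N
        rw [Fin.sum_univ_eq_sum_range
          (fun m : ℕ => g (y k + m * x - x) - g (y k + m * x)) N]
        rw [show (∑ m ∈ Finset.range N, (g (y k + m * x - x) - g (y k + m * x))) =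
          g (y k + (0 : ℕ) * x - x) - g (y k + N * x - x) from ?_]
        · have h0 := hg (y k + (0 : ℕ) * x - x)
          have h1 := hg (y k + N * x - x)
          exact (norm_sub_le _ _).trans (by linarith)
        · rw [← this]
          refine Finset.sum_congr rfl fun m _ => ?_
          congr 2
          push_cast; ring
      refine (norm_sum_le_of_le _ fun k _ => hk k).trans ?_
      rw [Finset.sum_const, Finset.card_univ, nsmul_eq_mul]
      have h2 : 2 ≤ ε * N := by
        rw [div_lt_iff₀ hε] at hN; linarith
      have : 2 * (Fintype.card κ * B) ≤ ε * N * (Fintype.card κ * B) :=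
        mul_le_mul_of_nonneg_right h2 (by positivity)
      linarith
    · rw [Fintype.sum_prod_type_right]
      refine (norm_sum_le_of_le _ (fun m _ => ?_)).trans
        (b := ∑ _m : Fin N, ε * B * Fintype.card κ) ?_
      · have := hy x hx (fun t => g (t + (m : ℕ) * a)) B fun t => hg _
        simpa only [sub_add_eq_add_sub] using this
      · rw [Finset.sum_const, Finset.card_univ, nsmul_eq_mul, Fintype.card_fin]
        exact le_of_eq (by ring)

/-! ### Positive definiteness via matrices -/

namespace IsPositiveDefiniteFun

theorem map_neg {f : ℝ → ℂ} (hf : IsPositiveDefiniteFun f) (x : ℝ) : f (-x) = star (f x) := by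
  have := (hf 2 ![0, x]).1.apply 0 1
  simpa using this.symm

theorem sum_nonneg {f : ℝ → ℂ} (hf : IsPositiveDefiniteFun f) {ι : Type*} [Fintype ι]
    (x : ι → ℝ) (c : ι → ℂ) : 0 ≤ ∑ i, ∑ j, star (c i) * f (x i - x j) * c j := by
  let e := Fintype.equivFin ι
  have h := (hf (Fintype.card ι) (x ∘ e.symm)).dotProduct_mulVec_nonneg (c ∘ e.symm)
  rw [← e.symm.sum_comp]
  refine h.trans_eq ?_
  simp only [dotProduct, Matrix.mulVec, Finset.mul_sum]
  refine Finset.sum_congr rfl fun i _ => ?_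
  rw [← e.symm.sum_comp]
  simp [mul_assoc]

theorem of_sum_nonneg {f : ℝ → ℂ} (hs : ∀ x, f (-x) = star (f x))
    (h : ∀ (n : ℕ) (x : Fin n → ℝ) (c : Fin n → ℂ),
      0 ≤ ∑ i, ∑ j, star (c i) * f (x i - x j) * c j) : IsPositiveDefiniteFun f := by
  intro n x
  refine Matrix.PosSemidef.of_dotProduct_mulVec_nonneg ?_ fun c => (h n x c).trans_eq ?_
  · ext i j
    rw [Matrix.conjTranspose_apply, Matrix.of_apply, Matrix.of_apply, ← neg_sub (x i) (x j), hs,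
      star_star]
  · simp [dotProduct, Matrix.mulVec, Finset.mul_sum, mul_assoc]

theorem norm_le {f : ℝ → ℂ} (hf : IsPositiveDefiniteFun f) (x : ℝ) : ‖f x‖ ≤ ‖f 0‖ := by
  have h0 : 0 ≤ f 0 := by simpa using hf.sum_nonneg (ι := Unit) (fun _ => 0) fun _ => 1
  by_cases hx : f x = 0
  · simp [hx]
  have hx' : (0 : ℝ) < ‖f x‖ := norm_pos_iff.2 hx
  -- These weights turn the form into `2 * ‖f x‖ ^ 2 * (f 0 - ‖f x‖)`.
  have h := hf.sum_nonneg ![0, x] ![(‖f x‖ : ℂ), -f x]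
  simp [Fin.sum_univ_two, hf.map_neg] at h
  have h1 : star (f x) * f x = (‖f x‖ : ℂ) ^ 2 := by
    simpa using Complex.conj_mul' (f x)
  have h2 := Complex.nonneg_iff.1 h0
  have h3 : f 0 = (‖f 0‖ : ℂ) := by
    rw [Complex.norm_of_nonneg' h0]
  simp only [starRingEnd_apply] at h
  rw [show (‖f x‖ : ℂ) * f 0 * ‖f x‖ + -(‖f x‖ * star (f x) * f x) +
      (-(star (f x) * f x * ‖f x‖) + star (f x) * f 0 * f x) =
      2 * ‖f x‖ ^ 2 * (f 0 - ‖f x‖) by linear_combination (f 0 - 2 * ‖f x‖) * h1, h3] at h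
  norm_cast at h
  by_contra hlt
  nlinarith [sq_pos_of_pos hx']

theorem of_tendsto {F : ℕ → ℝ → ℂ} {f : ℝ → ℂ} (hF : ∀ n, IsPositiveDefiniteFun (F n))
    (h : ∀ x, Tendsto (fun n => F n x) atTop (𝓝 (f x))) : IsPositiveDefiniteFun f := by
  refine of_sum_nonneg (fun x => ?_) fun n x c => ?_
  · refine tendsto_nhds_unique (h (-x)) ?_
    simp only [(hF _).map_neg]
    exact (h x).star
  · refine ge_of_tendsto' (f := fun m => ∑ i, ∑ j, star (c i) * F m (x i - x j) * c j) (x := atTop)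
      ?_ fun m => (hF m).sum_nonneg x c
    exact tendsto_finsetSum _ fun i _ => tendsto_finsetSum _ fun j _ =>
      ((h _).const_mul _).mul_const _

theorem add {f g : ℝ → ℂ} (hf : IsPositiveDefiniteFun f) (hg : IsPositiveDefiniteFun g) :
    IsPositiveDefiniteFun (fun x => f x + g x) := fun n x => (hf n x).add (hg n x)

theorem mul {f g : ℝ → ℂ} (hf : IsPositiveDefiniteFun f) (hg : IsPositiveDefiniteFun g) :
    IsPositiveDefiniteFun (fun x => f x * g x) := fun n x => (hf n x).hadamard (hg n x)

theorem const {a : ℝ} (ha : 0 ≤ a) : IsPositiveDefiniteFun (fun _ => (a : ℂ)) := by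
  refine of_sum_nonneg (fun x => by simp) fun n x c => ?_
  have : ∑ i, ∑ j, star (c i) * (a : ℂ) * c j = a * (star (∑ i, c i) * ∑ i, c i) := by
    rw [star_sum, Finset.sum_mul_sum]
    simp only [Finset.mul_sum]
    exact Finset.sum_congr rfl fun i _ => Finset.sum_congr rfl fun j _ => by ring
  rw [this]
  exact mul_nonneg (by exact_mod_cast ha) (star_mul_self_nonneg _)

/-- A bounded Hermitian function which is conditionally positive definite becomes positive definite
after adding a constant. -/
theorem add_const_of_conditionally {g : ℝ → ℂ} {B : ℝ} (hB : ∀ x, ‖g x‖ ≤ B)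
    (hs : ∀ x, g (-x) = star (g x))
    (hg : ∀ (ι : Type) [Fintype ι] (x : ι → ℝ) (c : ι → ℂ), ∑ i, c i = 0 →
      0 ≤ ∑ i, ∑ j, star (c i) * g (x i - x j) * c j) :
    IsPositiveDefiniteFun (fun x => g x + (3 * B : ℝ)) := by
  have hB0 : 0 ≤ B := (norm_nonneg _).trans (hB 0)
  refine of_sum_nonneg (fun x => by simp [hs]) fun n x c => ?_
  set s := ∑ i, c i with hs_def
  set Q := ∑ i, ∑ j, star (c i) * g (x i - x j) * c j with hQ
  have hsplit : ∑ i, ∑ j, star (c i) * (g (x i - x j) + (3 * B : ℝ)) * c j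
      = Q + (3 * B : ℝ) * (star s * s) := by
    rw [hs_def, star_sum, Finset.sum_mul_sum, hQ]
    simp only [Finset.mul_sum, ← Finset.sum_add_distrib]
    exact Finset.sum_congr rfl fun i _ => Finset.sum_congr rfl fun j _ => by ring
  have hQs : star Q = Q := by
    rw [hQ]
    simp only [star_sum]
    rw [Finset.sum_comm]
    refine Finset.sum_congr rfl fun i _ => Finset.sum_congr rfl fun j _ => ?_
    rw [← neg_sub (x i) (x j), hs]
    simp; ring
  have hss : star s * s = ((‖s‖ ^ 2 : ℝ) : ℂ) := by simpa using Complex.conj_mul' s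
  have hQim : Q.im = 0 := Complex.conj_eq_iff_im.1 hQs
  suffices hre : -(3 * B * ‖s‖ ^ 2) ≤ Q.re by
    rw [hsplit, hss, Complex.nonneg_iff]
    refine ⟨?_, ?_⟩
    · rw [← Complex.ofReal_mul, Complex.add_re, Complex.ofReal_re]; linarith
    · rw [← Complex.ofReal_mul, Complex.add_im, Complex.ofReal_im, hQim, add_zero]
  set L := ∑ i, ‖c i‖ with hL
  suffices key : ∀ ε : ℝ, 0 < ε → -(3 * B * ‖s‖ ^ 2) ≤ Q.re + ε * (2 * L * ‖s‖ * B) by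
    refine ge_of_tendsto (x := 𝓝[>] (0 : ℝ)) (f := fun ε => Q.re + ε * (2 * L * ‖s‖ * B)) ?_
      (eventually_mem_nhdsWithin.mono key)
    have : Continuous fun ε : ℝ => Q.re + ε * (2 * L * ‖s‖ * B) := by fun_prop
    simpa using (this.tendsto 0).mono_left nhdsWithin_le_nhds
  intro ε hε
  obtain ⟨κ, _, _, y, hy⟩ := exists_almost_invariant_family (Finset.univ.image x) hε
  set M : ℝ := ((Fintype.card κ : ℕ) : ℝ) with hM
  have hM0 : 0 < M := Nat.cast_pos.2 Fintype.card_pos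
  set d : ℂ := s / M with hd
  have hdM : M * ‖d‖ = ‖s‖ := by
    rw [hd, norm_div, Complex.norm_real, Real.norm_of_nonneg hM0.le]; field_simp
  set A₁ := ∑ k, g (- y k) with hA₁
  set A₂ := ∑ k, g (y k) with hA₂
  have hA₁' : ‖A₁‖ ≤ M * B := (norm_sum_le_of_le _ fun k _ => hB _).trans (by simp [hM])
  have hA₂' : ‖A₂‖ ≤ M * B := (norm_sum_le_of_le _ fun k _ => hB _).trans (by simp [hM])
  -- Almost invariance makes the cross sums nearly independent of `i`.
  have hE₁ : ∀ i, ‖∑ k, g (x i - y k) - A₁‖ ≤ ε * B * M := fun i => by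
    have := hy (x i) (by simp) (fun t => g (-t)) B fun t => hB _
    simpa [hA₁, Finset.sum_sub_distrib] using this
  have hE₂ : ∀ i, ‖∑ k, g (y k - x i) - A₂‖ ≤ ε * B * M := fun i => by
    have := hy (x i) (by simp) g B hB
    simpa [hA₂, Finset.sum_sub_distrib] using this
  set A₃ := ∑ k, ∑ l, g (y k - y l) with hA₃
  have hA₃' : ‖A₃‖ ≤ M * (M * B) := by
    refine (norm_sum_le_of_le _ fun k _ => norm_sum_le_of_le _ fun l _ => hB _).trans ?_
    simp [hM]
  have hpos := hg (Fin n ⊕ κ) (Sum.elim x y) (Sum.elim c fun _ => -d) (by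
    have : (M : ℂ) ≠ 0 := by exact_mod_cast hM0.ne'
    simp only [Fintype.sum_sum_type, Sum.elim_inl, Sum.elim_inr, ← hs_def, Finset.sum_const,
      Finset.card_univ, nsmul_eq_mul, hd]
    rw [← Complex.ofReal_natCast, ← hM]
    field_simp
    ring)
  -- The last bracket has three terms, each at most `B * ‖s‖ ^ 2`: this is the source of `3 * B`.
  -- The two sums before it are `O(ε)`.
  have hexp : ∑ i, ∑ j, star (Sum.elim c (fun _ : κ => -d) i) *
      g (Sum.elim x y i - Sum.elim x y j) * Sum.elim c (fun _ => -d) j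
      = Q - (∑ i, star (c i) * (∑ k, g (x i - y k) - A₁)) * d
        - star d * (∑ j, (∑ k, g (y k - x j) - A₂) * c j)
        + (star d * d * A₃ - star s * A₁ * d - star d * A₂ * s) := by
    simp only [Fintype.sum_sum_type, Sum.elim_inl, Sum.elim_inr, Finset.sum_add_distrib, ← hQ]
    have e1 : ∑ i, ∑ k, star (c i) * g (x i - y k) * -d =
        -(∑ i, star (c i) * (∑ k, g (x i - y k) - A₁)) * d - star s * A₁ * d := by
      simp only [mul_sub, Finset.sum_sub_distrib, ← Finset.sum_mul, ← Finset.mul_sum, hs_def,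
        star_sum]
      ring
    have e2 : ∑ k, ∑ j, star (-d) * g (y k - x j) * c j =
        -star d * (∑ j, (∑ k, g (y k - x j) - A₂) * c j) - star d * A₂ * s := by
      rw [Finset.sum_comm]
      simp only [sub_mul, Finset.sum_sub_distrib, ← Finset.sum_mul, ← Finset.mul_sum, hs_def,
        star_neg, mul_assoc]
      ring
    have e3 : ∑ k, ∑ l, star (-d) * g (y k - y l) * -d = star d * d * A₃ := by
      simp only [← Finset.sum_mul, ← Finset.mul_sum, star_neg, hA₃]
      ring
    rw [e1, e2, e3]
    ring
  rw [hexp] at hpos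
  have hre := (Complex.nonneg_iff.1 hpos).1
  have n1 : ‖(∑ i, star (c i) * (∑ k, g (x i - y k) - A₁)) * d‖ ≤ ε * L * ‖s‖ * B := by
    rw [norm_mul]
    calc _ ≤ (∑ i, ‖c i‖ * (ε * B * M)) * ‖d‖ := by
          gcongr
          refine norm_sum_le_of_le _ fun i _ => ?_
          rw [norm_mul, norm_star]
          gcongr
          exact hE₁ i
      _ = ε * L * (M * ‖d‖) * B := by rw [← Finset.sum_mul]; ring
      _ = _ := by rw [hdM]
  have n2 : ‖star d * (∑ j, (∑ k, g (y k - x j) - A₂) * c j)‖ ≤ ε * L * ‖s‖ * B := by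
    rw [norm_mul, norm_star]
    calc _ ≤ ‖d‖ * (∑ i, (ε * B * M) * ‖c i‖) := by
          gcongr
          refine norm_sum_le_of_le _ fun i _ => ?_
          rw [norm_mul]
          gcongr
          exact hE₂ i
      _ = ε * L * (M * ‖d‖) * B := by rw [← Finset.mul_sum]; ring
      _ = _ := by rw [hdM]
  have n3 : ‖star d * d * A₃ - star s * A₁ * d - star d * A₂ * s‖ ≤ 3 * B * ‖s‖ ^ 2 := by
    refine (norm_sub_le _ _).trans ((add_le_add_left (norm_sub_le _ _) _).trans ?_)
    simp only [norm_mul, norm_star]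
    calc _ ≤ ‖d‖ * ‖d‖ * (M * (M * B)) + ‖s‖ * (M * B) * ‖d‖ + ‖d‖ * (M * B) * ‖s‖ := by gcongr
      _ = (M * ‖d‖) ^ 2 * B + 2 * ‖s‖ * (M * ‖d‖) * B := by ring
      _ = _ := by rw [hdM]; ring
  simp only [Complex.add_re, Complex.sub_re Q, Complex.sub_re (Q - _)] at hre
  have m1 := (Complex.abs_re_le_norm _).trans n1
  have m2 := (Complex.abs_re_le_norm _).trans n2
  have m3 := (Complex.abs_re_le_norm _).trans n3
  rw [abs_le] at m1 m2 m3
  linarith [m1.1, m2.1, m3.2]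

end IsPositiveDefiniteFun

/-! ### Transforms of finite measures -/

theorem isFourierPositive_iff_charFun {f : ℝ → ℂ} :
    IsFourierPositive f ↔ ∃ μ : Measure ℝ, IsFiniteMeasure μ ∧ ∀ x, f x = charFun μ x := by
  simp only [IsFourierPositive, charFun_apply_real, mul_comm Complex.I, mul_right_comm _ Complex.I]

namespace IsFourierPositive

theorem add {f g : ℝ → ℂ} (hf : IsFourierPositive f) (hg : IsFourierPositive g) :
    IsFourierPositive (fun x => f x + g x) := by
  obtain ⟨μ, _, hμ⟩ := hf
  obtain ⟨ν, _, hν⟩ := hg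
  refine ⟨μ + ν, inferInstance, fun x => ?_⟩
  have (ρ : Measure ℝ) [IsFiniteMeasure ρ] :
      Integrable (fun t : ℝ => Complex.exp (Complex.I * x * t)) ρ := by
    refine (integrable_const (1 : ℝ)).mono (by fun_prop) (ae_of_all _ fun t => ?_)
    rw [show Complex.I * x * t = ((x * t : ℝ) : ℂ) * Complex.I by push_cast; ring,
      Complex.norm_exp_ofReal_mul_I, norm_one]
  rw [integral_add_measure (this μ) (this ν), ← hμ, ← hν]

theorem mul {f g : ℝ → ℂ} (hf : IsFourierPositive f) (hg : IsFourierPositive g) :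
    IsFourierPositive (fun x => f x * g x) := by
  rw [isFourierPositive_iff_charFun] at *
  obtain ⟨μ, _, hμ⟩ := hf
  obtain ⟨ν, _, hν⟩ := hg
  exact ⟨μ.conv ν, inferInstance, fun x => by rw [charFun_conv, hμ, hν]⟩

theorem const_mul {f : ℝ → ℂ} (hf : IsFourierPositive f) {a : ℝ} (ha : 0 ≤ a) :
    IsFourierPositive (fun x => (a : ℂ) * f x) := by
  obtain ⟨μ, _, hμ⟩ := hf
  refine ⟨a.toNNReal • μ, inferInstance, fun x => ?_⟩
  rw [integral_smul_nnreal_measure, ← hμ, NNReal.smul_def, Real.coe_toNNReal a ha, Complex.real_smul]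

theorem const {a : ℝ} (ha : 0 ≤ a) : IsFourierPositive (fun _ => (a : ℂ)) := by
  have : IsFourierPositive (fun _ => 1) := ⟨Measure.dirac 0, inferInstance, fun x => by simp⟩
  simpa using this.const_mul ha

theorem continuous {f : ℝ → ℂ} (hf : IsFourierPositive f) : Continuous f := by
  obtain ⟨μ, _, hμ⟩ := hf
  rw [show f = _ from funext hμ]
  refine continuous_of_dominated (bound := fun _ => 1) (fun x => by fun_prop)
    (fun x => ae_of_all _ fun t => ?_) (integrable_const _) (ae_of_all _ fun t => by fun_prop)
  rw [show Complex.I * x * t = ((x * t : ℝ) : ℂ) * Complex.I by push_cast; ring,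
    Complex.norm_exp_ofReal_mul_I]

/-- **Lévy continuity theorem**, for probability measures whose characteristic functions converge
pointwise to a function which is continuous at the origin. -/
theorem of_tendsto_charFun {μ : ℕ → Measure ℝ} [∀ n, IsProbabilityMeasure (μ n)] {f : ℝ → ℂ}
    (hf : ContinuousAt f 0) (h : ∀ x, Tendsto (fun n => charFun (μ n) x) atTop (𝓝 (f x))) :
    IsFourierPositive f := by
  rw [isFourierPositive_iff_charFun]
  have ht := isTightMeasureSet_of_tendsto_charFun hf h
  let P : ℕ → ProbabilityMeasure ℝ := fun n => ⟨μ n, inferInstance⟩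
  have hc : IsCompact (closure (Set.range P)) := by
    refine isCompact_closure_of_isTightMeasureSet ?_
    convert ht using 1
    ext ν
    exact ⟨fun ⟨_, ⟨n, hn⟩, hν⟩ => ⟨n, by rw [← hν, ← hn]; rfl⟩,
      fun ⟨n, hn⟩ => ⟨P n, ⟨n, rfl⟩, hn⟩⟩
  obtain ⟨ν, -, φ, hφ, hν⟩ := hc.tendsto_subseq fun n => subset_closure (Set.mem_range_self n)
  refine ⟨ν, inferInstance, fun x => ?_⟩
  exact tendsto_nhds_unique ((h x).comp hφ.tendsto_atTop)
    (ProbabilityMeasure.tendsto_iff_tendsto_charFun.1 hν x)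

theorem of_tendsto {F : ℕ → ℝ → ℂ} {f : ℝ → ℂ} (hF : ∀ n, IsFourierPositive (F n))
    (hf : ContinuousAt f 0) (h : ∀ x, Tendsto (fun n => F n x) atTop (𝓝 (f x))) :
    IsFourierPositive f := by
  simp only [isFourierPositive_iff_charFun] at hF
  choose μ _ hμ using hF
  have hm : Tendsto (fun n => (μ n).real Set.univ) atTop (𝓝 (f 0).re) := by
    refine ((Complex.continuous_re.tendsto _).comp (h 0)).congr fun n => ?_
    simp [hμ]
  -- The total masses tend to `(f 0).re`. If this is zero the limit vanishes; otherwise normalize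
  -- the tail of the sequence to probability measures.
  by_cases h0 : (f 0).re = 0
  · have hf0 : ∀ x, f x = (0 : ℝ) := fun x => by
      refine tendsto_nhds_unique (h x) (squeeze_zero_norm (fun n => ?_) (h0 ▸ hm))
      rw [hμ]
      exact norm_charFun_le x
    rw [show f = _ from funext hf0]
    exact const le_rfl
  have hpos : 0 < (f 0).re :=
    (ge_of_tendsto' hm fun n => measureReal_nonneg).lt_of_ne' h0
  obtain ⟨N, hN⟩ := eventually_atTop.1 (hm.eventually_const_lt hpos)
  let ν : ℕ → Measure ℝ := fun n => ((μ (n + N)) Set.univ)⁻¹ • μ (n + N)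
  have hne : ∀ n, μ (n + N) ≠ 0 := fun n h => by simpa [h] using hN (n + N) (by omega)
  have : ∀ n, IsProbabilityMeasure (ν n) := fun n => by
    have : NeZero (μ (n + N)) := ⟨hne n⟩
    exact isProbabilityMeasureSMul
  have key : IsFourierPositive (fun x => ((f 0).re⁻¹ : ℝ) * f x) := by
    refine of_tendsto_charFun (μ := ν) (continuousAt_const.mul hf) fun x => ?_
    have e : ∀ n, charFun (ν n) x = (((μ (n + N)).real Set.univ)⁻¹ : ℝ) * F (n + N) x := by
      intro n
      rw [hμ, charFun_apply, charFun_apply, integral_smul_measure, Complex.real_smul,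
        ENNReal.toReal_inv, Measure.real]
    simp only [e]
    exact (((Complex.continuous_ofReal.tendsto _).comp (hm.inv₀ h0)).mul (h x)).comp
      (tendsto_add_atTop_nat N)
  have := key.const_mul hpos.le
  refine (funext fun x => ?_ : f = _) ▸ this
  rw [← mul_assoc, ← Complex.ofReal_mul, mul_inv_cancel₀ h0, Complex.ofReal_one, one_mul]

end IsFourierPositive

/-! ### Exponentials -/

theorem exp_partialSum_mem {P : (ℝ → ℂ) → Prop} (hconst : ∀ a : ℝ, 0 ≤ a → P fun _ => (a : ℂ))
    (hadd : ∀ f g, P f → P g → P fun x => f x + g x)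
    (hmul : ∀ f g, P f → P g → P fun x => f x * g x) {f : ℝ → ℂ} (hf : P f) (n : ℕ) :
    P fun x => ∑ m ∈ Finset.range n, f x ^ m / (m.factorial : ℂ) := by
  have hpow : ∀ m, P fun x => f x ^ m := fun m => by
    induction m with
    | zero => simpa using hconst 1 zero_le_one
    | succ m ih => simpa only [pow_succ] using hmul _ _ ih hf
  induction n with
  | zero => simpa using hconst 0 le_rfl
  | succ n ih =>
    simp only [Finset.sum_range_succ]
    refine hadd _ _ ih ?_
    have := hmul _ _ (hpow n) (hconst (n.factorial : ℝ)⁻¹ (by positivity))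
    simpa [div_eq_mul_inv] using this

theorem tendsto_exp_partialSum (z : ℂ) :
    Tendsto (fun n => ∑ m ∈ Finset.range n, z ^ m / (m.factorial : ℂ)) atTop
      (𝓝 (Complex.exp z)) := by
  rw [Complex.exp_eq_exp_ℂ]
  exact (NormedSpace.expSeries_div_hasSum_exp z).tendsto_sum_nat

theorem IsPositiveDefiniteFun.exp {f : ℝ → ℂ} (hf : IsPositiveDefiniteFun f) :
    IsPositiveDefiniteFun fun x => Complex.exp (f x) :=
  of_tendsto (exp_partialSum_mem (fun _ => const) (fun _ _ => add) (fun _ _ => mul) hf)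
    fun _ => tendsto_exp_partialSum _

theorem IsFourierPositive.exp {f : ℝ → ℂ} (hf : IsFourierPositive f) :
    IsFourierPositive fun x => Complex.exp (f x) :=
  of_tendsto (exp_partialSum_mem (fun _ => const) (fun _ _ => add) (fun _ _ => mul) hf)
    hf.continuous.cexp.continuousAt fun _ => tendsto_exp_partialSum _

/-! ### Logarithms -/

theorem IsBoundedAwayFromZero.ne_zero {f : ℝ → ℂ} (hf : IsBoundedAwayFromZero f) (x : ℝ) :
    f x ≠ 0 := by
  obtain ⟨c, hc, h⟩ := hf
  exact norm_pos_iff.1 (hc.trans_le (h x))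

theorem IsBoundedAwayFromZero.exists_norm_log_le {f : ℝ → ℂ} (hf : IsBoundedAwayFromZero f)
    {R : ℝ} (hR : ∀ x, ‖f x‖ ≤ R) : ∃ B, ∀ x, ‖Complex.log (f x)‖ ≤ B := by
  obtain ⟨c, hc, h⟩ := hf
  refine ⟨|Real.log c| + |Real.log R| + Real.pi, fun x => ?_⟩
  refine (Complex.norm_le_abs_re_add_abs_im _).trans (add_le_add ?_ ?_)
  · rw [Complex.log_re, abs_le]
    have h1 := Real.log_le_log hc (h x)
    have h2 := Real.log_le_log (hc.trans_le (h x)) (hR x)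
    constructor <;>
      linarith [neg_abs_le (Real.log c), le_abs_self (Real.log R), abs_nonneg (Real.log c),
        abs_nonneg (Real.log R)]
  · rw [Complex.log_im]
    exact Complex.abs_arg_le_pi _

theorem tendsto_inv_mul_exp_sub_one {l : ℕ → ℝ} (hl : Tendsto l atTop (𝓝 0))
    (hl0 : ∀ n, l n ≠ 0) (z : ℂ) :
    Tendsto (fun n => ((l n)⁻¹ : ℝ) * (Complex.exp (z * l n) - 1)) atTop (𝓝 z) := by
  have h : HasDerivAt (fun t : ℂ => Complex.exp (z * t)) z 0 := by
    simpa using ((hasDerivAt_id (0 : ℂ)).const_mul z).cexp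
  have hl' : Tendsto (fun n => (l n : ℂ)) atTop (𝓝[≠] 0) := by
    refine tendsto_nhdsWithin_iff.2 ⟨?_, Eventually.of_forall fun n => ?_⟩
    · simpa [Function.comp_def] using (Complex.continuous_ofReal.tendsto 0).comp hl
    · simpa using hl0 n
  simpa [Function.comp_def] using h.tendsto_slope_zero.comp hl'

/-- If all positive powers of `f` are positive definite, then `log f` is conditionally positive
definite. If moreover `f` is bounded away from zero, `log f` is positive definite up to a
constant. -/
theorem IsPositiveDefiniteFun.exists_log_sub {f : ℝ → ℂ}
    (hf : ∀ l : ℝ, 0 < l → IsPositiveDefiniteFun (fun x => f x ^ (l : ℂ)))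
    (hf0 : IsBoundedAwayFromZero f) :
    ∃ C : ℂ, IsPositiveDefiniteFun (fun x => Complex.log (f x) - C) := by
  have h1 : IsPositiveDefiniteFun f := by simpa using hf 1 one_pos
  obtain ⟨B, hB⟩ := hf0.exists_norm_log_le h1.norm_le
  let l : ℕ → ℝ := fun n => 1 / ((n : ℝ) + 1)
  have hl : ∀ n, 0 < l n := fun n => by positivity
  have ht : ∀ x, Tendsto (fun n => ((l n)⁻¹ : ℝ) * (f x ^ (l n : ℂ) - 1)) atTop
      (𝓝 (Complex.log (f x))) := fun x => by
    simp only [Complex.cpow_def_of_ne_zero (hf0.ne_zero x)]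
    exact tendsto_inv_mul_exp_sub_one tendsto_one_div_add_atTop_nhds_zero_nat
      (fun n => (hl n).ne') _
  have h := IsPositiveDefiniteFun.add_const_of_conditionally hB (fun x => ?_) fun ι _ x c hc => ?_
  · exact ⟨-(3 * B : ℝ), by simpa only [sub_neg_eq_add] using h⟩
  · refine tendsto_nhds_unique (ht (-x)) ((ht x).star.congr fun n => ?_)
    rw [(hf _ (hl n)).map_neg]
    simp
  · refine ge_of_tendsto' (x := atTop) (f := fun n => ∑ i, ∑ j,
      star (c i) * (((l n)⁻¹ : ℝ) * (f (x i - x j) ^ (l n : ℂ) - 1)) * c j) ?_ fun n => ?_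
    · exact tendsto_finsetSum _ fun i _ => tendsto_finsetSum _ fun j _ =>
        ((ht _).const_mul _).mul_const _
    · have e : ∑ i, ∑ j, star (c i) * (((l n)⁻¹ : ℝ) * (f (x i - x j) ^ (l n : ℂ) - 1)) * c j =
          ((l n)⁻¹ : ℝ) * (∑ i, ∑ j, star (c i) * f (x i - x j) ^ (l n : ℂ) * c j -
            star (∑ i, c i) * ∑ i, c i) := by
        rw [star_sum, Finset.sum_mul_sum]
        simp only [Finset.mul_sum, ← Finset.sum_sub_distrib]
        exact Finset.sum_congr rfl fun i _ => Finset.sum_congr rfl fun j _ => by ring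
      rw [e, hc, mul_zero, sub_zero]
      exact mul_nonneg (by exact_mod_cast (inv_pos.2 (hl n)).le) ((hf _ (hl n)).sum_nonneg x c)

/-! ### Logarithms in the Fourier sense -/

/-- The mass of `r < |x|` is controlled by an average of `1 - charFun μ`; a uniform bound makes the
estimate independent of `r`, so `r` may shrink to 0. -/
theorem measureReal_compl_singleton_zero_le {μ : Measure ℝ} [IsProbabilityMeasure μ] {a : ℝ}
    (h : ∀ x, ‖1 - charFun μ x‖ ≤ a) : μ.real {0}ᶜ ≤ 2 * a := by
  have hr : ∀ r : ℝ, 0 < r → μ.real {x | r < |x|} ≤ 2 * a := fun r hr => by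
    refine (measureReal_abs_gt_le_integral_charFun hr).trans ?_
    have := intervalIntegral.norm_integral_le_of_norm_le_const (a := -2 * r⁻¹) (b := 2 * r⁻¹)
      (f := fun t => 1 - charFun μ t) (C := a) fun x _ => h x
    calc _ ≤ 2⁻¹ * r * (a * |2 * r⁻¹ - -2 * r⁻¹|) := by gcongr
      _ = 2 * a := by
        rw [show 2 * r⁻¹ - -2 * r⁻¹ = 4 * r⁻¹ by ring, abs_of_pos (by positivity)]
        field_simp; ring
  have hU : ({0}ᶜ : Set ℝ) = ⋃ n : ℕ, {x : ℝ | 1 / ((n : ℝ) + 1) < |x|} := by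
    ext x
    simp only [Set.mem_compl_iff, Set.mem_singleton_iff, Set.mem_iUnion, Set.mem_ofPred_eq]
    refine ⟨fun hx => exists_nat_one_div_lt (abs_pos.2 hx), ?_⟩
    rintro ⟨n, hn⟩ rfl
    rw [abs_zero] at hn
    exact absurd hn (by positivity : (0 : ℝ) < 1 / ((n : ℝ) + 1)).le.not_gt
  have hmono : Monotone fun n : ℕ => {x : ℝ | 1 / ((n : ℝ) + 1) < |x|} := fun m n hmn x hx =>
    lt_of_le_of_lt (Nat.one_div_le_one_div hmn) (show 1 / ((m : ℝ) + 1) < |x| from hx)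
  rw [hU]
  refine le_of_tendsto' ((ENNReal.tendsto_toReal (measure_ne_top μ _)).comp
    (tendsto_measure_iUnion_atTop hmono)) fun n => hr _ (by positivity)

theorem charFun_restrict_compl_singleton_zero (μ : Measure ℝ) [IsProbabilityMeasure μ] (x : ℝ) :
    charFun (μ.restrict {0}ᶜ) x = charFun μ x - 1 + μ.real {0}ᶜ := by
  have hi : Integrable (fun t : ℝ => Complex.exp (x * t * Complex.I)) μ := by
    refine (integrable_const (1 : ℝ)).mono (by fun_prop) (ae_of_all _ fun t => ?_)
    rw [← Complex.ofReal_mul, Complex.norm_exp_ofReal_mul_I, norm_one]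
  have h0 : ∫ t in {0}, Complex.exp (x * t * Complex.I) ∂μ = μ.real {0} := by
    rw [Measure.restrict_singleton, integral_smul_measure, integral_dirac]
    simp [Measure.real]
  rw [charFun_apply_real, charFun_apply_real,
    ← integral_add_compl (measurableSet_singleton (0 : ℝ)) hi, h0,
    probReal_compl_eq_one_sub (measurableSet_singleton (0 : ℝ))]
  push_cast
  ring

theorem IsFourierPositive.exists_log_sub {f : ℝ → ℂ}
    (hf : ∀ l : ℝ, 0 < l → IsFourierPositive (fun x => f x ^ (l : ℂ)))
    (hf0 : IsBoundedAwayFromZero f) :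
    ∃ C : ℂ, IsFourierPositive (fun x => Complex.log (f x) - C) := by
  have h1 : IsFourierPositive f := by simpa using hf 1 one_pos
  have hcont := h1.continuous
  obtain ⟨μ₁, _, hμ₁⟩ := isFourierPositive_iff_charFun.1 h1
  set r : ℝ := μ₁.real Set.univ with hr_def
  have hfr : f 0 = r := by rw [hμ₁, charFun_zero]
  have hr : 0 < r := measureReal_nonneg.lt_of_ne' fun h => hf0.ne_zero 0 (by
    rw [hfr, hr_def, h, Complex.ofReal_zero])
  obtain ⟨B, hB⟩ := hf0.exists_norm_log_le fun x => (hμ₁ x ▸ norm_charFun_le x : ‖f x‖ ≤ r)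
  -- Normalized so that `w 0 = 0`, which makes the measures below probabilities.
  set w : ℝ → ℂ := fun x => Complex.log (f x) - Real.log r with hw
  obtain ⟨D, hD0, hD⟩ : ∃ D, 0 < D ∧ ∀ x, ‖w x‖ ≤ D := by
    have hB0 : 0 ≤ B := (norm_nonneg _).trans (hB 0)
    refine ⟨B + |Real.log r| + 1, by positivity, fun x => (norm_sub_le _ _).trans ?_⟩
    rw [Complex.norm_real, Real.norm_eq_abs]
    linarith [hB x]
  have hpow : ∀ (l : ℝ) x, f x ^ (l : ℂ) = (r ^ l : ℝ) * Complex.exp (w x * l) := fun l x => by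
    rw [Complex.cpow_def_of_ne_zero (hf0.ne_zero x), Real.rpow_def_of_pos hr, Complex.ofReal_exp,
      ← Complex.exp_add, hw]
    congr 1
    push_cast
    ring
  -- The factor `D⁻¹` ensures `‖w x * l n‖ ≤ 1`, where `‖exp z - 1‖ ≤ 2 * ‖z‖` applies.
  let l : ℕ → ℝ := fun n => D⁻¹ * (1 / ((n : ℝ) + 1))
  have hl : ∀ n, 0 < l n := fun n => by positivity
  have hl0 : Tendsto l atTop (𝓝 0) := by
    simpa [l] using tendsto_one_div_add_atTop_nhds_zero_nat.const_mul D⁻¹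
  have hlD : ∀ n, D * l n ≤ 1 := fun n => by
    rw [mul_inv_cancel_left₀ hD0.ne', div_le_one (by positivity)]
    linarith [(Nat.cast_nonneg n : (0 : ℝ) ≤ n)]
  have hex : ∀ n, ∃ μ : Measure ℝ, IsProbabilityMeasure μ ∧
      ∀ x, charFun μ x = Complex.exp (w x * l n) := fun n => by
    have h := (hf (l n) (hl n)).const_mul (a := (r ^ l n)⁻¹) (by positivity)
    obtain ⟨μ, _, hμ⟩ := isFourierPositive_iff_charFun.1 h
    have hμ' : ∀ x, charFun μ x = Complex.exp (w x * l n) := fun x => by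
      rw [← hμ, hpow, ← mul_assoc, ← Complex.ofReal_mul,
        inv_mul_cancel₀ (Real.rpow_pos_of_pos hr _).ne', Complex.ofReal_one, one_mul]
    refine ⟨μ, ⟨?_⟩, hμ'⟩
    have h0 := hμ' 0
    rw [charFun_zero, hw] at h0
    simp only [hfr, ← Complex.ofReal_log hr.le, sub_self, zero_mul, Complex.exp_zero] at h0
    have h0' : μ.real Set.univ = 1 := by exact_mod_cast h0
    rwa [Measure.real, ENNReal.toReal_eq_one_iff] at h0'
  choose μ _ hμ using hex
  let m : ℕ → ℝ := fun n => (l n)⁻¹ * (μ n).real {0}ᶜ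
  have hm : ∀ n, m n ∈ Set.Icc 0 (4 * D) := fun n => by
    refine ⟨mul_nonneg (inv_pos.2 (hl n)).le measureReal_nonneg, ?_⟩
    have hle : ∀ x, ‖w x * l n‖ ≤ D * l n := fun x => by
      rw [norm_mul, Complex.norm_real, Real.norm_of_nonneg (hl n).le]
      exact mul_le_mul_of_nonneg_right (hD x) (hl n).le
    have := measureReal_compl_singleton_zero_le (μ := μ n) (a := 2 * (D * l n)) fun x => by
      rw [hμ, norm_sub_rev]
      exact (Complex.norm_exp_sub_one_le ((hle x).trans (hlD n))).trans (by linarith [hle x])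
    rw [inv_mul_le_iff₀ (hl n)]
    linarith
  obtain ⟨M, -, φ, hφ, hM⟩ := isCompact_Icc.tendsto_subseq hm
  refine ⟨(Real.log r - M : ℝ), IsFourierPositive.of_tendsto
    (F := fun n x => ((l (φ n))⁻¹ : ℝ) * charFun ((μ (φ n)).restrict {0}ᶜ) x) (fun n => ?_) ?_
    fun x => ?_⟩
  · exact const_mul (isFourierPositive_iff_charFun.2 ⟨_, inferInstance, fun _ => rfl⟩)
      (inv_pos.2 (hl _)).le
  -- Only continuity at 0 is needed, and `f 0 = r > 0` avoids the branch cut.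
  · refine (hcont.continuousAt.clog ?_).sub continuousAt_const
    rw [hfr]
    exact Complex.ofReal_mem_slitPlane.2 hr
  · have ht := ((tendsto_inv_mul_exp_sub_one hl0 (fun n => (hl n).ne') (w x)).comp
      hφ.tendsto_atTop).add ((Complex.continuous_ofReal.tendsto _).comp hM)
    rw [show Complex.log (f x) - (Real.log r - M : ℝ) = w x + M by
      simp only [hw]; push_cast; ring]
    refine ht.congr fun n => ?_
    rw [charFun_restrict_compl_singleton_zero, hμ]
    simp only [Function.comp, m]
    push_cast
    ring

theorem mainTheorem4 :
    -- positive definiteness in the sense of positive semidefinite matrices `[f (x_i - x_j)]`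
    ((∀ f : ℝ → ℂ, IsPositiveDefiniteFun f →
        ∀ k : ℝ, 0 < k → IsPositiveDefiniteFun (fun x => Complex.exp ((k : ℂ) * f x))) ∧
      (∀ f : ℝ → ℂ,
        (∀ l : ℝ, 0 < l → IsPositiveDefiniteFun (fun x => f x ^ (l : ℂ))) →
        IsBoundedAwayFromZero f →
        ∃ C : ℂ, IsPositiveDefiniteFun (fun x => Complex.log (f x) - C))) ∧
    -- positive definiteness in the sense of nonnegative Fourier transforms
    ((∀ f : ℝ → ℂ, IsFourierPositive f →
        ∀ k : ℝ, 0 < k → IsFourierPositive (fun x => Complex.exp ((k : ℂ) * f x))) ∧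
      (∀ f : ℝ → ℂ,
        (∀ l : ℝ, 0 < l → IsFourierPositive (fun x => f x ^ (l : ℂ))) →
        IsBoundedAwayFromZero f →
        ∃ C : ℂ, IsFourierPositive (fun x => Complex.log (f x) - C))) := by
  refine ⟨⟨fun f hf k hk => ?_, fun f => IsPositiveDefiniteFun.exists_log_sub⟩,
    fun f hf k hk => ?_, fun f => IsFourierPositive.exists_log_sub⟩
  · exact ((IsPositiveDefiniteFun.const hk.le).mul hf).exp
  · exact (hf.const_mul hk.le).exp
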